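/- Let $\mathfrak H_+,\mathfrak H_-$ be complex Hilbert spaces (either may be $\{0\}$), let $\mathfrak H=\mathfrak H_+\oplus\mathfrak H_-$ be their orthogonal sum, and let $D_0\subset\mathbb C$ be an open neighbourhood of $[0,1]$. Assume the following. (i) For each sign $\pm$ there are a dense subspace $\mathfrak D_\pm\subset\mathfrak H_\pm$, independent of $\lambda$, and sesquilinear forms $\mathfrak a^\lambda_\pm$ with domain $\mathfrak D_\pm$, $\lambda\in D_0$, that are closed and sectorial, symmetric for real $\lambda\in D_0$, and such that $\lambda\mapsto\mathfrak a^\lambda_\pm[u,v]$ is holomorphic on $D_0$ for all $u,v\in\mathfrak D_\pm$. Let $\mathcal A^\lambda_\pm$ be the operator associated with $\mathfrak a^\lambda_\pm$: $u\in\mathfrak D(\mathcal A^\lambda_\pm)$ and $\mathcal A^\lambda_\pm u=w$ if and only if $u\in\mathfrak D_\pm$, $w\in\mathfrak H_\pm$ and $\mathfrak a^\lambda_\pm[u,v]=\langle w,v\rangle$ for all $v\in\mathfrak D_\pm$ (inner product and forms being linear in the first argument). (ii) $\mathcal A^\lambda_\pm>1$ for every $\lambda\in[0,1]$, that is, $\langle\mathcal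 A^\lambda_\pm u,u\rangle>\|u\|^2$ for all $0\ne u\in\mathfrak D(\mathcal A^\lambda_\pm)$. (iii) $\{\mathcal K^\lambda\}_{\lambda\in[0,1]}$ is a family of bounded symmetric operators on $\mathfrak H$, and $\lambda\mapsto\mathcal K^\lambda u$ is continuous on $[0,1]$ for every $u\in\mathfrak H$. (iv) There are bounded symmetric operators $\mathcal P_\pm$ on $\mathfrak H_\pm$ that are relatively compact with respect to the forms $\mathfrak a^\lambda_\pm$ for $\lambda\in[0,1]$ (whenever $u_n\in\mathfrak D_\pm$ and both $\|u_n\|$ and $\mathfrak a^\lambda_\pm[u_n,u_n]$ are bounded, $\mathcal P_\pm u_n$ has a convergent subsequence), such that $\mathcal K^\lambda=\mathcal K^\lambda\mathcal P$ for all $\lambda\in[0,1]$, where $\mathcal P=\operatorname{diag}(\mathcal P_+,\mathcal P_-)$. Let $\mathcal A^\lambda=\operatorname{diag}(\mathcal A^\lambda_+,-\mathcal A^\lambda_-)$ and $\mathcal M^\lambda=\mathcal A^\lambda+\mathcal K^\lambda$ for $\lambda\in[0,1]$, with domain $\mathfrak D(\mathcal A^\lambda_+)\oplus\mathfrak D(\mathcal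 A^\lambda_-)$. Then the family $\{\mathcal M^\lambda\}_{\lambda\in[0,1]}$ is continuous in the norm resolvent sense: every $\mathcal M^\lambda$ is self-adjoint, and for every $z\in\mathbb C\setminus\mathbb R$ the map $\lambda\mapsto(\mathcal M^\lambda-z)^{-1}$ is continuous from $[0,1]$ to the bounded operators on $\mathfrak H$ with the operator norm. -/

import Mathlib

open Filter Topology Set

section Forms

variable {H : Type*} [NormedAddCommGroup H] [InnerProductSpace ℂ H]

/-- A sesquilinear form `a` with domain `D` is sectorial: its numerical range lies in a sector
`{ζ : |arg (ζ - γ)| ≤ θ}` with vertex `γ ∈ ℝ` and semi-angle `θ ∈ [0, π/2)`; here `C = tan θ`.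
Forms are antilinear in the first and linear in the second argument. -/
def IsSectorialForm {D : Submodule ℂ H} (a : D →ₗ⋆[ℂ] D →ₗ[ℂ] ℂ) : Prop :=
  ∃ γ C : ℝ, 0 ≤ C ∧ ∀ u : D,
    γ * ‖u‖ ^ 2 ≤ (a u u).re ∧ |(a u u).im| ≤ C * ((a u u).re - γ * ‖u‖ ^ 2)

/-- A form is closed: if `uₙ ∈ D` converges in `H` to `u` and `a[uₙ - uₘ] → 0` as `n, m → ∞`,
then `u ∈ D` and `a[uₙ - u] → 0`. -/
def IsClosedForm {D : Submodule ℂ H} (a : D →ₗ⋆[ℂ] D →ₗ[ℂ] ℂ) : Prop :=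
  ∀ (u : ℕ → D) (x : H), Tendsto (fun n => (u n : H)) atTop (𝓝 x) →
    Tendsto (fun p : ℕ × ℕ => a (u p.1 - u p.2) (u p.1 - u p.2)) atTop (𝓝 0) →
    ∃ y : D, (y : H) = x ∧ Tendsto (fun n => a (u n - y) (u n - y)) atTop (𝓝 0)

/-- A form is symmetric (Hermitian). -/
def IsSymmetricForm {D : Submodule ℂ H} (a : D →ₗ⋆[ℂ] D →ₗ[ℂ] ℂ) : Prop :=
  ∀ u v : D, a v u = starRingEnd ℂ (a u v)

/-- The family of forms `a z`, `z ∈ D₀`, all with the same domain `D`, is holomorphic of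
type (a): `D` is dense, each form is sectorial and closed, and `z ↦ a z u v` is holomorphic. -/
structure IsHolomorphicOfTypeA {D : Submodule ℂ H} (a : ℂ → D →ₗ⋆[ℂ] D →ₗ[ℂ] ℂ)
    (D₀ : Set ℂ) : Prop where
  dense : Dense (D : Set H)
  sectorial : ∀ z ∈ D₀, IsSectorialForm (a z)
  closed : ∀ z ∈ D₀, IsClosedForm (a z)
  holomorphic : ∀ u v : D, DifferentiableOn ℂ (fun z => a z u v) D₀

/-- The graph of the operator associated with a form: all pairs `(u, w)` with `u ∈ D` and
`a(v, u) = ⟪v, w⟫` for all `v ∈ D`. -/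
def formGraph {D : Submodule ℂ H} (a : D →ₗ⋆[ℂ] D →ₗ[ℂ] ℂ) : Submodule ℂ (H × H) where
  carrier := {p | ∃ u : D, (u : H) = p.1 ∧ ∀ v : D, a v u = inner ℂ (v : H) p.2}
  add_mem' := by
    rintro p q ⟨u, hu, hu'⟩ ⟨w, hw, hw'⟩
    exact ⟨u + w, by simp [hu, hw], fun v => by simp [hu', hw']⟩
  zero_mem' := ⟨0, by simp, fun v => by simp⟩
  smul_mem' := by
    rintro c p ⟨u, hu, hu'⟩
    exact ⟨c • u, by simp [hu], fun v => by simp [hu']⟩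

/-- For a densely defined form this graph is the graph of a (single-valued) operator. -/
theorem formGraph_snd_eq_zero {D : Submodule ℂ H} (hD : Dense (D : Set H))
    (a : D →ₗ⋆[ℂ] D →ₗ[ℂ] ℂ) (p : H × H) (hp : p ∈ formGraph a) (h0 : p.1 = 0) : p.2 = 0 := by
  obtain ⟨u, hu, h⟩ := hp
  have hu0 : u = 0 := Subtype.ext (by simpa using hu.trans h0)
  subst hu0
  refine hD.eq_zero_of_inner_right (𝕜 := ℂ) fun v hv => ?_
  simpa using (h ⟨v, hv⟩).symm

/-- The operator associated with a densely defined form: its domain consists of the `u ∈ D` for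
which there is a `w ∈ H` with `a(v, u) = ⟪v, w⟫` for all `v ∈ D`, and it maps `u` to `w`. -/
noncomputable def formOperator {D : Submodule ℂ H} (a : D →ₗ⋆[ℂ] D →ₗ[ℂ] ℂ) : H →ₗ.[ℂ] H :=
  (formGraph a).toLinearPMap

/-- `T > c` in the sense of quadratic forms. -/
def IsStrictlyAbove (T : H →ₗ.[ℂ] H) (c : ℝ) : Prop :=
  ∀ u : T.domain, u ≠ 0 → c * ‖u‖ ^ 2 < (inner ℂ (u : H) (T u)).re

/-- `P` is relatively compact with respect to the form `a`: for each sequence in `D` that is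
bounded in the form norm of `a` (that is, `‖uₙ‖` and `a[uₙ]` are bounded), the sequence `P uₙ` has
a convergent subsequence. -/
def IsRelativelyFormCompact (P : H →L[ℂ] H) {D : Submodule ℂ H} (a : D →ₗ⋆[ℂ] D →ₗ[ℂ] ℂ) :
    Prop :=
  ∀ u : ℕ → D, (∃ C : ℝ, ∀ n, ‖u n‖ ≤ C ∧ ‖a (u n) (u n)‖ ≤ C) →
    ∃ (φ : ℕ → ℕ) (y : H), StrictMono φ ∧ Tendsto (fun n => P (u (φ n))) atTop (𝓝 y)

end Forms

section Resolvents

variable {H : Type*} [NormedAddCommGroup H] [InnerProductSpace ℂ H]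

/-- The bounded operator `R` is the inverse of `T - z`. -/
def IsResolventAt (T : H →ₗ.[ℂ] H) (z : ℂ) (R : H →L[ℂ] H) : Prop :=
  (∀ x : H, ∃ h : R x ∈ T.domain, T ⟨R x, h⟩ - z • R x = x) ∧
    ∀ u : T.domain, R (T u - z • (u : H)) = u

theorem IsResolventAt.unique {T : H →ₗ.[ℂ] H} {z : ℂ} {R S : H →L[ℂ] H}
    (hR : IsResolventAt T z R) (hS : IsResolventAt T z S) : R = S := by
  ext x
  obtain ⟨h, hx⟩ := hS.1 x
  have := hR.2 ⟨S x, h⟩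
  simpa [hx] using this

/-- The resolvent set of an unbounded operator. -/
def unboundedResolventSet (T : H →ₗ.[ℂ] H) : Set ℂ :=
  {z | ∃ R : H →L[ℂ] H, IsResolventAt T z R}

open Classical in
/-- The resolvent `(T - z)⁻¹`, for `z` in the resolvent set (and `0` otherwise). -/
noncomputable def unboundedResolvent (T : H →ₗ.[ℂ] H) (z : ℂ) : H →L[ℂ] H :=
  if h : ∃ R : H →L[ℂ] H, IsResolventAt T z R then h.choose else 0

/-- A family of self-adjoint operators is continuous in the norm resolvent sense: each non-real
`z` lies in all resolvent sets, and `x ↦ (T x - z)⁻¹` is continuous in the operator norm. -/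
def NormResolventContinuousOn {X : Type*} [TopologicalSpace X] [CompleteSpace H]
    (T : X → H →ₗ.[ℂ] H) (s : Set X) : Prop :=
  (∀ x ∈ s, IsSelfAdjoint (T x)) ∧
    ∀ z : ℂ, z.im ≠ 0 →
      (∀ x ∈ s, z ∈ unboundedResolventSet (T x)) ∧
        ContinuousOn (fun x => unboundedResolvent (T x) z) s

end Resolvents

section Blocks

variable {H₁ H₂ : Type*} [NormedAddCommGroup H₁] [InnerProductSpace ℂ H₁]
  [NormedAddCommGroup H₂] [InnerProductSpace ℂ H₂]

/-- The block diagonal operator `diag(S, T)` on `H₁ ⊕ H₂`, with domain `D(S) ⊕ D(T)`. -/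
def blockDiagonal (S : H₁ →ₗ.[ℂ] H₁) (T : H₂ →ₗ.[ℂ] H₂) :
    WithLp 2 (H₁ × H₂) →ₗ.[ℂ] WithLp 2 (H₁ × H₂) where
  domain := (S.domain.prod T.domain).comap (WithLp.linearEquiv 2 ℂ (H₁ × H₂)).toLinearMap
  toFun :=
    { toFun := fun u => WithLp.toLp 2 (S ⟨(u : WithLp 2 (H₁ × H₂)).fst, u.2.1⟩,
        T ⟨(u : WithLp 2 (H₁ × H₂)).snd, u.2.2⟩)
      map_add' := fun u v => by
        rw [← WithLp.toLp_add, Prod.mk_add_mk, ← S.map_add, ← T.map_add]; rfl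
      map_smul' := fun c u => by
        rw [RingHom.id_apply, ← WithLp.toLp_smul, Prod.smul_mk, ← S.map_smul, ← T.map_smul]; rfl }

/-- The bounded block diagonal operator `diag(P, Q)` on `H₁ ⊕ H₂`. -/
noncomputable def boundedBlockDiagonal (P : H₁ →L[ℂ] H₁) (Q : H₂ →L[ℂ] H₂) :
    WithLp 2 (H₁ × H₂) →L[ℂ] WithLp 2 (H₁ × H₂) :=
  (WithLp.prodContinuousLinearEquiv 2 ℂ H₁ H₂).symm.toContinuousLinearMap ∘L
    (P.prodMap Q) ∘L (WithLp.prodContinuousLinearEquiv 2 ℂ H₁ H₂).toContinuousLinearMap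

/-- The operator `diag(A₊, -A₋) + K` on `H₊ ⊕ H₋`, with `A₊`, `A₋` the operators associated with
the forms `a₊`, `a₋` and `K` bounded; its domain is `D(A₊) ⊕ D(A₋)`. -/
noncomputable def perturbedOperator {D₁ : Submodule ℂ H₁} {D₂ : Submodule ℂ H₂}
    (a₁ : D₁ →ₗ⋆[ℂ] D₁ →ₗ[ℂ] ℂ) (a₂ : D₂ →ₗ⋆[ℂ] D₂ →ₗ[ℂ] ℂ)
    (K : WithLp 2 (H₁ × H₂) →L[ℂ] WithLp 2 (H₁ × H₂)) :
    WithLp 2 (H₁ × H₂) →ₗ.[ℂ] WithLp 2 (H₁ × H₂) :=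
  K.toLinearMap +ᵥ blockDiagonal (formOperator a₁) (-formOperator a₂)

end Blocks

/-! ### Closed forms as Hilbert spaces, and the bounded inverses of their operators -/

section FormSpace

variable {H : Type*} [NormedAddCommGroup H] [InnerProductSpace ℂ H] {D : Submodule ℂ H}

/-! Everything is expressed through bounded operators. The gap makes `diag(A₊, -A₋)` the inverse of
a bounded injective self-adjoint `B = diag(A₊⁻¹, -A₋⁻¹)`, and the resolvent of the perturbed
operator is `B C⁻¹` with `C = 1 + (K - z) B`. For non-real `z` symmetry makes `C` invertible
(`isUnit_birmanSchwinger`). Inversion is norm continuous on the units, so it suffices that `B` and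
`K B` depend norm continuously on the parameter.

For `B`: holomorphy bounds `a^λ[u,v] - a^μ[u,v]` by `O(|λ - μ|)` as `λ → μ`, for each pair `u, v`.
The uniform boundedness principle turns this into a bound relative to the form norm at `μ`
(`exists_uniform_form_bound`), and such a bound controls the inverses (`norm_inverse_sub_le`).

For `K B = K (P B)`: `B` sends bounded sets to form-bounded sets, so `P B` is compact. Strong
convergence of `K` is uniform on relatively compact sets, hence `K P B` converges in norm
(`tendsto_comp_of_compact`). -/

/-- A closed symmetric form bounded from below by `1`. -/
structure IsCoerciveForm (a : D →ₗ⋆[ℂ] D →ₗ[ℂ] ℂ) : Prop where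
  symm : IsSymmetricForm a
  sq_norm_le : ∀ u : D, ‖u‖ ^ 2 ≤ (a u u).re
  closed : IsClosedForm a

/-- The domain of a coercive form `a`, to be equipped with the inner product `a`. -/
def FormSpace (a : D →ₗ⋆[ℂ] D →ₗ[ℂ] ℂ) (_ : IsCoerciveForm a) : Type _ := D

namespace FormSpace

variable {a b : D →ₗ⋆[ℂ] D →ₗ[ℂ] ℂ} {ha : IsCoerciveForm a} {hb : IsCoerciveForm b}

instance : AddCommGroup (FormSpace a ha) := inferInstanceAs (AddCommGroup D)

instance : Module ℂ (FormSpace a ha) := inferInstanceAs (Module ℂ D)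

/-- The inner product given by the form. -/
@[reducible]
noncomputable def core (ha : IsCoerciveForm a) : InnerProductSpace.Core ℂ (FormSpace a ha) where
  inner u v := a u v
  conj_inner_symm u v := (ha.symm v u).symm
  re_inner_nonneg u := (sq_nonneg _).trans (ha.sq_norm_le u)
  add_left u v w := LinearMap.map_add₂ a (show D from u) (show D from v) (show D from w)
  smul_left u v c := LinearMap.map_smulₛₗ₂ a c (show D from u) (show D from v)
  definite u h := by
    have h1 := ha.sq_norm_le u
    change a u u = 0 at h
    rw [h] at h1
    have h2 : ‖(show D from u)‖ = 0 := by
      have := norm_nonneg (show D from u)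
      have h3 : ‖(show D from u)‖ ^ 2 ≤ 0 := h1
      nlinarith
    exact norm_eq_zero.1 h2

noncomputable instance : NormedAddCommGroup (FormSpace a ha) := (core ha).toNormedAddCommGroup

noncomputable instance : InnerProductSpace ℂ (FormSpace a ha) := .ofCore (core ha).toCore

variable (ha) in
/-- The identity, as a map from the form domain to the form space. -/
def ofDomain : D ≃ₗ[ℂ] FormSpace a ha := LinearEquiv.refl ℂ D

theorem inner_ofDomain (u v : D) : inner ℂ (ofDomain ha u) (ofDomain ha v) = a u v := rfl

theorem sq_norm_ofDomain (u : D) : ‖ofDomain ha u‖ ^ 2 = (a u u).re := by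
  rw [@norm_sq_eq_re_inner ℂ, inner_ofDomain]; rfl

theorem norm_le_norm_ofDomain (u : D) : ‖u‖ ≤ ‖ofDomain ha u‖ :=
  le_of_sq_le_sq ((ha.sq_norm_le u).trans_eq (sq_norm_ofDomain u).symm) (norm_nonneg _)

theorem form_self_eq (u : D) : a u u = (‖ofDomain ha u‖ ^ 2 : ℝ) := by
  rw [← inner_ofDomain (ha := ha), inner_self_eq_norm_sq_to_K]; norm_cast

theorem norm_form_le (u v : D) : ‖a u v‖ ≤ ‖ofDomain ha u‖ * ‖ofDomain ha v‖ := by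
  rw [← inner_ofDomain (ha := ha)]; exact norm_inner_le_norm _ _

variable (ha) in
/-- The embedding of the form space into the Hilbert space. -/
noncomputable def embed : FormSpace a ha →L[ℂ] H :=
  (D.subtype ∘ₗ (ofDomain ha).symm.toLinearMap).mkContinuous 1 fun u => by
    simpa using norm_le_norm_ofDomain (ha := ha) ((ofDomain ha).symm u)

theorem embed_ofDomain (u : D) : embed ha (ofDomain ha u) = u := rfl

theorem norm_embed_le : ‖embed ha‖ ≤ 1 := LinearMap.mkContinuous_norm_le _ zero_le_one _

theorem embed_injective : Function.Injective (embed ha) := fun _ _ h =>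
  (ofDomain ha).symm.injective (Subtype.ext h)

/-- Closedness is completeness in the form norm: a Cauchy sequence converges in `H` because the
embedding is bounded, and closedness upgrades this to convergence in form norm. -/
instance [CompleteSpace H] : CompleteSpace (FormSpace a ha) := by
  refine Metric.complete_of_cauchySeq_tendsto fun u hu => ?_
  obtain ⟨x, hx⟩ := cauchySeq_tendsto_of_complete 
    ((embed ha).uniformContinuous.comp_cauchySeq hu)
  obtain ⟨y, -, hy⟩ := ha.closed (fun n => (ofDomain ha).symm (u n)) x hx (by
    have h1 : Tendsto (fun p : ℕ × ℕ => ((‖u p.1 - u p.2‖ ^ 2 : ℝ) : ℂ)) atTop (𝓝 0) := by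
      have h2 : Tendsto (fun p : ℕ × ℕ => ‖u p.1 - u p.2‖) atTop (𝓝 0) := by
        have h3 := cauchySeq_iff_tendsto_dist_atTop_0.1 hu
        simpa [dist_eq_norm] using h3
      have h3 := (Complex.continuous_ofReal.tendsto 0).comp (by simpa using h2.pow 2)
      simpa [Function.comp_def] using h3
    refine h1.congr fun p => ?_
    rw [form_self_eq (ha := ha), map_sub, LinearEquiv.apply_symm_apply,
      LinearEquiv.apply_symm_apply])
  refine ⟨ofDomain ha y, tendsto_iff_norm_sub_tendsto_zero.2 ?_⟩
  have h1 : Tendsto (fun n => ‖u n - ofDomain ha y‖ ^ 2) atTop (𝓝 0) := by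
    have h2 := (Complex.continuous_re.tendsto 0).comp hy
    refine h2.congr fun n => ?_
    simp only [Function.comp_apply]
    rw [← sq_norm_ofDomain (ha := ha), map_sub, LinearEquiv.apply_symm_apply]
  have h2 := (Real.continuous_sqrt.tendsto 0).comp h1
  simpa [Function.comp_def] using h2

/-- Two coercive closed forms with the same domain have equivalent form norms. -/
theorem exists_norm_le [CompleteSpace H] (ha : IsCoerciveForm a) (hb : IsCoerciveForm b) :
    ∃ C : ℝ, 0 ≤ C ∧ ∀ u : D, ‖ofDomain hb u‖ ≤ C * ‖ofDomain ha u‖ := by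
  let f : FormSpace a ha →ₗ[ℂ] FormSpace b hb :=
    (ofDomain hb).toLinearMap ∘ₗ (ofDomain ha).symm.toLinearMap
  -- Closed graph theorem: convergence in either form norm implies convergence in `H`, where both
  -- limits must agree.
  have hf : Continuous f := f.continuous_of_seq_closed_graph fun u x y hux huy => by
    apply embed_injective (ha := hb)
    refine tendsto_nhds_unique (((embed hb).continuous.tendsto y).comp huy) ?_
    exact ((embed ha).continuous.tendsto x).comp hux
  let F : FormSpace a ha →L[ℂ] FormSpace b hb := ⟨f, hf⟩
  exact ⟨‖F‖, norm_nonneg F, fun u => F.le_opNorm (ofDomain ha u)⟩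

section Inverse

variable [CompleteSpace H]

variable (ha) in
/-- The adjoint of the embedding, with values in the form domain: it maps `w` to the solution `u`
of `a(v, u) = ⟪v, w⟫`. -/
noncomputable def solve (w : H) : D := (ofDomain ha).symm ((embed ha).adjoint w)

theorem form_solve (v : D) (w : H) : a v (solve ha w) = inner ℂ (v : H) w := by
  rw [← inner_ofDomain (ha := ha), solve, LinearEquiv.apply_symm_apply,
    ContinuousLinearMap.adjoint_inner_right]
  rfl

theorem norm_ofDomain_solve_le (w : H) : ‖ofDomain ha (solve ha w)‖ ≤ ‖w‖ := by
  rw [solve, LinearEquiv.apply_symm_apply]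
  refine ((embed ha).adjoint.le_opNorm w).trans ?_
  rw [LinearIsometryEquiv.norm_map]
  exact mul_le_of_le_one_left (norm_nonneg _) norm_embed_le

theorem eq_solve_iff (u : D) (w : H) : u = solve ha w ↔ ∀ v : D, a v u = inner ℂ (v : H) w := by
  refine ⟨fun h v => h ▸ form_solve v w, fun h => ?_⟩
  apply (ofDomain ha).injective
  refine ext_inner_left ℂ fun v => ?_
  obtain ⟨v, rfl⟩ := (ofDomain ha).surjective v
  rw [inner_ofDomain, inner_ofDomain, h, form_solve]

variable (ha) in
/-- The inverse of the operator associated with a coercive form. -/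
noncomputable def inverse : H →L[ℂ] H := embed ha ∘L (embed ha).adjoint

theorem inverse_apply (w : H) : inverse ha w = solve ha w := rfl

theorem isSelfAdjoint_inverse : IsSelfAdjoint (inverse ha) := by
  rw [ContinuousLinearMap.isSelfAdjoint_iff', inverse, ContinuousLinearMap.adjoint_comp,
    ContinuousLinearMap.adjoint_adjoint]

theorem inverse_injective (hD : Dense (D : Set H)) : Function.Injective (inverse ha) := by
  rw [injective_iff_map_eq_zero]
  intro w hw
  have h0 : solve ha w = 0 := Subtype.ext hw
  refine hD.eq_zero_of_inner_right (𝕜 := ℂ) fun v hv => ?_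
  have := form_solve (ha := ha) ⟨v, hv⟩ w
  rw [h0] at this
  simpa using this.symm

/-- Replaces the unbounded operator by a bounded one; the perturbation lemmas below see it only
through this description of the graph. -/
theorem mem_graph_formOperator (hD : Dense (D : Set H)) (p : H × H) :
    p ∈ (formOperator a).graph ↔ p.1 = inverse ha p.2 := by
  rw [formOperator, Submodule.toLinearPMap_graph_eq _ (formGraph_snd_eq_zero hD a)]
  constructor
  · rintro ⟨u, hu, h⟩
    rw [← hu, inverse_apply, (eq_solve_iff u p.2).2 h]
  · intro h
    exact ⟨solve ha p.2, h.symm, fun v => form_solve v _⟩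

/-- The closure of the range of an adjoint is the orthogonal complement of the kernel, here trivial.
Thus the operator domain is a form core. -/
theorem dense_range_solve : DenseRange fun w => ofDomain ha (solve ha w) := by
  have h : (fun w => ofDomain ha (solve ha w)) = (embed ha).adjoint := by
    ext w; rw [solve, LinearEquiv.apply_symm_apply]
  rw [h]
  have h1 := (embed ha).orthogonal_ker
  rw [(LinearMap.ker_eq_bot).2 embed_injective, Submodule.bot_orthogonal_eq_top] at h1
  exact (Submodule.dense_iff_topologicalClosure_eq_top).2 h1.symm

end Inverse

end FormSpace

/-! ### From the lower bound of the operator to that of the form -/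

/-- The form `a + c ⟪·, ·⟫`. -/
noncomputable def shiftForm (a : D →ₗ⋆[ℂ] D →ₗ[ℂ] ℂ) (c : ℝ) : D →ₗ⋆[ℂ] D →ₗ[ℂ] ℂ :=
  a + (c : ℂ) • innerₛₗ ℂ

theorem shiftForm_apply (a : D →ₗ⋆[ℂ] D →ₗ[ℂ] ℂ) (c : ℝ) (u v : D) :
    shiftForm a c u v = a u v + c * inner ℂ (u : H) v := rfl

theorem re_shiftForm_self (a : D →ₗ⋆[ℂ] D →ₗ[ℂ] ℂ) (c : ℝ) (u : D) :
    (shiftForm a c u u).re = (a u u).re + c * ‖u‖ ^ 2 := by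
  rw [shiftForm_apply, inner_self_eq_norm_sq_to_K]
  simp [← Complex.ofReal_pow]

theorem IsClosedForm.shiftForm {a : D →ₗ⋆[ℂ] D →ₗ[ℂ] ℂ} (ha : IsClosedForm a) (c : ℝ) :
    IsClosedForm (shiftForm a c) := by
  have key {ι : Type} {l : Filter ι} {f : ι → D} (hf : Tendsto (fun i => (f i : H)) l (𝓝 0)) :
      Tendsto (fun i => (c : ℂ) * inner ℂ (f i : H) (f i)) l (𝓝 0) := by
    simpa using (hf.inner (𝕜 := ℂ) hf).const_mul (c : ℂ)
  intro u x hux hu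
  have hsub : Tendsto (fun p : ℕ × ℕ => ((u p.1 - u p.2 : D) : H)) atTop (𝓝 0) := by
    have h1 : Tendsto (fun p : ℕ × ℕ => (u p.1 : H)) atTop (𝓝 x) := by
      rw [← prod_atTop_atTop_eq]; exact hux.comp tendsto_fst
    have h2 : Tendsto (fun p : ℕ × ℕ => (u p.2 : H)) atTop (𝓝 x) := by
      rw [← prod_atTop_atTop_eq]; exact hux.comp tendsto_snd
    simpa using h1.sub h2
  obtain ⟨y, hy, h⟩ := ha u x hux (by
    simpa only [shiftForm_apply, add_sub_cancel_right, sub_zero] using hu.sub (key hsub))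
  refine ⟨y, hy, ?_⟩
  have hsub' : Tendsto (fun n => ((u n - y : D) : H)) atTop (𝓝 0) := by
    simpa [hy] using hux.sub_const x
  simpa only [shiftForm_apply, add_zero] using h.add (key hsub')

theorem IsSymmetricForm.shiftForm {a : D →ₗ⋆[ℂ] D →ₗ[ℂ] ℂ} (ha : IsSymmetricForm a) (c : ℝ) :
    IsSymmetricForm (shiftForm a c) := by
  intro u v
  rw [shiftForm_apply, shiftForm_apply, ha u v, map_add, map_mul, Complex.conj_ofReal,
    inner_conj_symm]

/-- A closed symmetric semibounded form is bounded from below by `1` if its operator is. -/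
theorem IsCoerciveForm.of_isStrictlyAbove [CompleteSpace H] {a : D →ₗ⋆[ℂ] D →ₗ[ℂ] ℂ}
    (hD : Dense (D : Set H)) (hsymm : IsSymmetricForm a) (hclosed : IsClosedForm a)
    (hsect : IsSectorialForm a) (hgap : IsStrictlyAbove (formOperator a) 1) :
    IsCoerciveForm a := by
  refine ⟨hsymm, fun u => ?_, hclosed⟩
  obtain ⟨γ, C, -, hγ⟩ := hsect
  -- Sectoriality supplies some lower bound `γ`; shifting it to `1` gives a form space before `a`
  -- itself is known to be coercive.
  have hb : IsCoerciveForm (_root_.shiftForm a (1 - γ)) :=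
    ⟨hsymm.shiftForm _, fun u => by rw [re_shiftForm_self]; linarith [(hγ u).1],
      hclosed.shiftForm _⟩
  -- This is the claim `1 ≤ a` shifted by `1 - γ`. Both sides are continuous in the form norm, so it
  -- is enough to check it on the operator domain, which is a core and where the gap hypothesis
  -- applies.
  have key : ∀ v : FormSpace _ hb, (2 - γ) * ‖FormSpace.embed hb v‖ ^ 2 ≤ ‖v‖ ^ 2 := by
    refine fun v => FormSpace.dense_range_solve.induction_on v
      (isClosed_le (by fun_prop) (by fun_prop)) fun w => ?_
    rw [FormSpace.embed_ofDomain, FormSpace.sq_norm_ofDomain, re_shiftForm_self]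
    set u := FormSpace.solve hb w with hu
    have hg : ((u : H), w - ((1 - γ : ℝ) : ℂ) • (u : H)) ∈ (formOperator a).graph := by
      rw [formOperator, Submodule.toLinearPMap_graph_eq _ (formGraph_snd_eq_zero hD a)]
      refine ⟨u, rfl, fun v => ?_⟩
      have := FormSpace.form_solve (ha := hb) v w
      rw [← hu, shiftForm_apply] at this
      rw [inner_sub_right, inner_smul_right, ← this]
      ring
    obtain ⟨y, hy, hy'⟩ := (LinearPMap.mem_graph_iff _).1 hg
    have h1 : (inner ℂ (y : H) (formOperator a y)).re = (a u u).re := by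
      have := FormSpace.form_solve (ha := hb) u w
      rw [← hu, shiftForm_apply] at this
      simp only at hy hy'
      rw [hy, hy', inner_sub_right, inner_smul_right, ← this]
      simp
    have h2 : ‖y‖ = ‖u‖ := congrArg norm hy
    have h3 : ‖(u : H)‖ = ‖u‖ := rfl
    rcases eq_or_ne y 0 with h0 | h0
    · have : ‖u‖ = 0 := by rw [← h2, h0, norm_zero]
      have hu0 : u = 0 := norm_eq_zero.1 this
      simp [hu0]
    · have := hgap y h0
      rw [h1, h2] at this
      rw [h3]
      linarith
  have := key (FormSpace.ofDomain hb u)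
  rw [FormSpace.embed_ofDomain, FormSpace.sq_norm_ofDomain, re_shiftForm_self] at this
  have h3 : ‖(u : H)‖ = ‖u‖ := rfl
  rw [h3] at this
  linarith

end FormSpace

/-! ### Resolvents and self-adjointness of bounded perturbations -/

section Perturbation

variable {H : Type*} [NormedAddCommGroup H] [InnerProductSpace ℂ H]

theorem LinearPMap.mem_graph_vadd (K : H →ₗ[ℂ] H) (T : H →ₗ.[ℂ] H) (p : H × H) :
    p ∈ (K +ᵥ T).graph ↔ (p.1, p.2 - K p.1) ∈ T.graph := by
  simp only [LinearPMap.mem_graph_iff]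
  constructor
  · rintro ⟨y, hy, h⟩
    refine ⟨y, hy, ?_⟩
    rw [← h, ← hy]
    change T y = (K y + T y) - K y
    abel
  · rintro ⟨y, hy, h⟩
    refine ⟨y, hy, ?_⟩
    change K y + T y = p.2
    rw [h, hy]
    abel

/-- If `T` is the inverse of `B`, this is `(T + K - z) B`. -/
noncomputable def birmanSchwinger (B K : H →L[ℂ] H) (z : ℂ) : H →L[ℂ] H := 1 + (K - z • 1) * B

theorem birmanSchwinger_apply (B K : H →L[ℂ] H) (z : ℂ) (x : H) :
    birmanSchwinger B K z x = x + (K (B x) - z • B x) := rfl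

/-- In `⟪B x, C x⟫`, where `C` is the Birman–Schwinger operator, the terms `⟪B x, x⟫` and `⟪B x, K B
x⟫` are real, so the imaginary part is `-Im z ‖B x‖²`; then Cauchy–Schwarz. -/
theorem abs_im_mul_norm_le {B K : H →L[ℂ] H} (hB : (B : H →ₗ[ℂ] H).IsSymmetric)
    (hK : (K : H →ₗ[ℂ] H).IsSymmetric) (z : ℂ) (x : H) :
    |z.im| * ‖B x‖ ≤ ‖birmanSchwinger B K z x‖ := by
  have h1 : (inner ℂ (B x) (birmanSchwinger B K z x)).im = - (z.im * ‖B x‖ ^ 2) := by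
    have hx : (inner ℂ (B x) x).im = 0 := by
      have := hB x x
      simp only [ContinuousLinearMap.coe_coe] at this
      have h2 := inner_conj_symm (𝕜 := ℂ) x (B x)
      rw [← this] at h2
      exact Complex.conj_eq_iff_im.1 h2
    have hKx : (inner ℂ (B x) (K (B x))).im = 0 := by
      have := hK (B x) (B x)
      simp only [ContinuousLinearMap.coe_coe] at this
      have h2 := inner_conj_symm (𝕜 := ℂ) (B x) (K (B x))
      rw [this] at h2
      exact Complex.conj_eq_iff_im.1 h2
    rw [birmanSchwinger_apply, inner_add_right, inner_sub_right, inner_smul_right,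
      inner_self_eq_norm_sq_to_K]
    simp [hx, hKx, ← Complex.ofReal_pow]
  have h2 : |z.im| * ‖B x‖ ^ 2 ≤ ‖B x‖ * ‖birmanSchwinger B K z x‖ := by
    calc |z.im| * ‖B x‖ ^ 2 = |(inner ℂ (B x) (birmanSchwinger B K z x)).im| := by
          rw [h1, abs_neg, abs_mul, abs_of_nonneg (sq_nonneg ‖B x‖)]
      _ ≤ _ := (Complex.abs_im_le_norm _).trans (norm_inner_le_norm _ _)
  rcases eq_or_ne ‖B x‖ 0 with h0 | h0
  · rw [h0, mul_zero]; exact norm_nonneg _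
  · have hp : 0 < ‖B x‖ := lt_of_le_of_ne (norm_nonneg _) h0.symm
    refine le_of_mul_le_mul_left ?_ hp
    linarith

/-- If `T` is the inverse of `B`, then the resolvent of `T + K` at `z` is `B ((T + K - z) B)⁻¹`. -/
theorem isResolventAt_vadd {T : H →ₗ.[ℂ] H} {B K : H →L[ℂ] H}
    (hT : ∀ p, p ∈ T.graph ↔ p.1 = B p.2) {z : ℂ} (hC : IsUnit (birmanSchwinger B K z)) :
    IsResolventAt (K.toLinearMap +ᵥ T) z (B * Ring.inverse (birmanSchwinger B K z)) := by
  have hM : ∀ p : H × H, p ∈ (K.toLinearMap +ᵥ T).graph ↔ p.1 = B (p.2 - K p.1) := fun p => by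
    rw [LinearPMap.mem_graph_vadd, hT]; rfl
  set R := Ring.inverse (birmanSchwinger B K z) with hR
  have h1 : ∀ x, birmanSchwinger B K z (R x) = x := fun x =>
    DFunLike.congr_fun (Ring.mul_inverse_cancel _ hC) x
  have h2 : ∀ x, R (birmanSchwinger B K z x) = x := fun x =>
    DFunLike.congr_fun (Ring.inverse_mul_cancel _ hC) x
  refine ⟨fun x => ?_, fun u => ?_⟩
  · have hmem : (B (R x), x + z • B (R x)) ∈ (K.toLinearMap +ᵥ T).graph := by
      rw [hM]
      have := h1 x
      rw [birmanSchwinger_apply] at this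
      dsimp only
      congr 1
      nth_rw 2 [← this]
      abel
    obtain ⟨y, hy, hy'⟩ := (LinearPMap.mem_graph_iff _).1 hmem
    dsimp only at hy hy'
    have hRx : (B * R) x = (y : H) := hy.symm
    have hdom : (B * R) x ∈ (K.toLinearMap +ᵥ T).domain := hRx ▸ y.2
    refine ⟨hdom, ?_⟩
    have hyy : (⟨(B * R) x, hdom⟩ : (K.toLinearMap +ᵥ T).domain) = y := Subtype.ext hRx
    rw [hyy, hy', hRx, hy, add_sub_cancel_right]
  · have hu := (hM _).1 (LinearPMap.mem_graph _ u)
    dsimp only at hu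
    set y := (K.toLinearMap +ᵥ T) u - K u with hy
    have h3 : birmanSchwinger B K z y = (K.toLinearMap +ᵥ T) u - z • (u : H) := by
      rw [birmanSchwinger_apply, ← hu, hy]; abel
    rw [← h3]
    change B (R (birmanSchwinger B K z y)) = u
    rw [h2, hu]

variable [CompleteSpace H]

/-- Since `x = C x - (K - z) B x` and `‖B x‖ ≤ ‖C x‖ / |Im z|`, `C` is bounded below: injective with
closed range. Its range is dense because the adjoint is injective. -/
theorem isUnit_birmanSchwinger {B K : H →L[ℂ] H} (hB : IsSelfAdjoint B)
    (hK : IsSelfAdjoint K) {z : ℂ} (hz : z.im ≠ 0) :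
    IsUnit (birmanSchwinger B K z) := by
  set C := birmanSchwinger B K z with hC
  have hBs := hB.isSymmetric
  have hKs := hK.isSymmetric
  have hz' : 0 < |z.im| := abs_pos.2 hz
  have hbound : ∀ x, ‖x‖ ≤ (1 + ‖K - z • (1 : H →L[ℂ] H)‖ / |z.im|) * ‖C x‖ := by
    intro x
    have h1 : x = C x - (K - z • (1 : H →L[ℂ] H)) (B x) := by
      rw [hC, birmanSchwinger_apply]; simp
    have h2 : ‖B x‖ ≤ ‖C x‖ / |z.im| := by
      rw [le_div_iff₀ hz', mul_comm]; exact abs_im_mul_norm_le hBs hKs z x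
    calc ‖x‖ = ‖C x - (K - z • (1 : H →L[ℂ] H)) (B x)‖ := by rw [← h1]
      _ ≤ ‖C x‖ + ‖(K - z • (1 : H →L[ℂ] H)) (B x)‖ := norm_sub_le _ _
      _ ≤ ‖C x‖ + ‖K - z • (1 : H →L[ℂ] H)‖ * (‖C x‖ / |z.im|) := by
          gcongr
          exact (ContinuousLinearMap.le_opNorm _ _).trans (by gcongr)
      _ = _ := by ring
  have hanti : AntilipschitzWith (Real.toNNReal (1 + ‖K - z • (1 : H →L[ℂ] H)‖ / |z.im|)) C :=
    ContinuousLinearMap.antilipschitz_of_bound C fun x => by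
      rw [Real.coe_toNNReal _ (by positivity)]; exact hbound x
  have hker : ∀ x, ContinuousLinearMap.adjoint C x = 0 → x = 0 := by
    intro x hx
    have hadj : ContinuousLinearMap.adjoint C = 1 + B * (K - star z • 1) := by
      rw [← ContinuousLinearMap.star_eq_adjoint, hC, birmanSchwinger]
      simp [star_mul, hB.star_eq, hK.star_eq]
    rw [hadj] at hx
    -- A kernel vector of the adjoint has the form `B y` with `y` in the kernel of the
    -- Birman–Schwinger operator at the conjugate point, where the same estimate forces `B y = 0`.
    have hx' : x = B (-(K x - star z • x)) := by
      rw [map_neg]; exact eq_neg_of_add_eq_zero_left hx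
    set y := -(K x - star z • x) with hy
    have h0 : birmanSchwinger B K (star z) y = 0 := by
      rw [birmanSchwinger_apply, ← hx', hy]; abel
    have := abs_im_mul_norm_le hBs hKs (star z) y
    rw [h0, norm_zero, ← hx'] at this
    have h1 : |(star z).im| = |z.im| := by simp
    rw [h1] at this
    exact norm_eq_zero.1 (le_antisymm (nonpos_of_mul_nonpos_right this hz') (norm_nonneg _))
  have hsurj : Function.Surjective C := by
    have hcl : IsClosed (C.range : Set H) := 
      hanti.isClosed_range C.uniformContinuous
    have h1 : C.rangeᗮ = ⊥ := by
      rw [ContinuousLinearMap.orthogonal_range, eq_bot_iff]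
      intro x hx
      exact hker x hx
    have h2 : C.range.topologicalClosure = ⊤ :=
      (Submodule.topologicalClosure_eq_top_iff).2 h1
    rw [hcl.submodule_topologicalClosure_eq] at h2
    exact LinearMap.range_eq_top.1 h2
  exact ContinuousLinearMap.isUnit_iff_bijective.2 ⟨hanti.injective, hsurj⟩

/-- The pairs `(B x, x + K B x)` make up the graph. Testing a pair of the adjoint graph against them
and moving `B` and `K` across the inner product gives back the equation `p.1 = B (p.2 - K p.1)` of
the graph itself. -/
theorem isSelfAdjoint_vadd {T : H →ₗ.[ℂ] H} {B K : H →L[ℂ] H}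
    (hT : ∀ p, p ∈ T.graph ↔ p.1 = B p.2) (hB : IsSelfAdjoint B)
    (hBi : Function.Injective B) (hK : IsSelfAdjoint K) :
    IsSelfAdjoint (K.toLinearMap +ᵥ T) := by
  set M := K.toLinearMap +ᵥ T with hMdef
  have hM : ∀ p : H × H, p ∈ M.graph ↔ p.1 = B (p.2 - K p.1) := fun p => by
    rw [hMdef, LinearPMap.mem_graph_vadd, hT]; rfl
  have hBs : ∀ x y, inner ℂ (B x) y = inner ℂ x (B y) := hB.isSymmetric
  have hKs : ∀ x y, inner ℂ (K x) y = inner ℂ x (K y) := hK.isSymmetric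
  have hBmem : ∀ x, (B x, x + K (B x)) ∈ M.graph := fun x => by rw [hM]; simp
  have hdense : Dense (M.domain : Set H) := by
    have h1 : (B.range)ᗮ = ⊥ := by
      rw [ContinuousLinearMap.orthogonal_range, hB.adjoint_eq]
      exact LinearMap.ker_eq_bot.2 hBi
    have h2 : Dense (B.range : Set H) := Submodule.dense_iff_topologicalClosure_eq_top.2
      ((Submodule.topologicalClosure_eq_top_iff).2 h1)
    refine h2.mono ?_
    rintro _ ⟨x, rfl⟩
    exact LinearPMap.mem_domain_of_mem_graph (hBmem x)
  refine LinearPMap.eq_of_eq_graph ?_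
  change M.adjoint.graph = M.graph
  rw [LinearPMap.adjoint_graph_eq_graph_adjoint hdense]
  ext p
  rw [Submodule.mem_adjoint_iff, hM]
  constructor
  · intro h
    refine ext_inner_left ℂ fun x => ?_
    have := h _ _ (hBmem x)
    rw [sub_eq_zero, inner_add_left, hKs, hBs, hBs] at this
    rw [map_sub, inner_sub_right, ← this]
    abel
  · intro h a b hab
    have := (hM _).1 hab
    dsimp only at this
    rw [sub_eq_zero]
    have h1 : inner ℂ (b - K a) p.1 = inner ℂ a (p.2 - K p.1) := by
      rw [h, ← hBs, ← this, ← h]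
    rw [inner_sub_left, inner_sub_right, hKs] at h1
    exact sub_left_injective h1

end Perturbation

/-! ### Norm continuity of the inverses -/

section Continuity

variable {H : Type*} [NormedAddCommGroup H] [InnerProductSpace ℂ H] [CompleteSpace H]
  {D : Submodule ℂ H}

open FormSpace

/-- Pointwise bounds for a sequence of differences of coercive forms are uniform with respect to
the form norm. -/
theorem exists_uniform_form_bound {a : ℕ → D →ₗ⋆[ℂ] D →ₗ[ℂ] ℂ} {b : D →ₗ⋆[ℂ] D →ₗ[ℂ] ℂ}
    (ha : ∀ n, IsCoerciveForm (a n)) (hb : IsCoerciveForm b) {δ : ℕ → ℝ} (hδ : ∀ n, 0 ≤ δ n)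
    (h : ∀ u v, ∃ C : ℝ, ∀ n, ‖a n u v - b u v‖ ≤ C * δ n) :
    ∃ C : ℝ, 0 ≤ C ∧
      ∀ n u v, ‖a n u v - b u v‖ ≤ C * δ n * ‖ofDomain hb u‖ * ‖ofDomain hb v‖ := by
  choose c hc0 hc using fun n => exists_norm_le hb (ha n)
  let L n : FormSpace b hb →ₗ⋆[ℂ] FormSpace b hb →ₗ[ℂ] ℂ :=
    ((a n - b).comp (ofDomain hb).symm.toLinearMap).compl₂ (ofDomain hb).symm.toLinearMap
  have hL n (u v : D) : L n (ofDomain hb u) (ofDomain hb v) = a n u v - b u v := rfl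
  -- The bound depends on `n` and only shows that each difference is continuous.
  let T n : FormSpace b hb →L⋆[ℂ] FormSpace b hb →L[ℂ] ℂ :=
    (L n).mkContinuous₂ (c n * c n + 1) fun u v => by
      obtain ⟨u, rfl⟩ := (ofDomain hb).surjective u
      obtain ⟨v, rfl⟩ := (ofDomain hb).surjective v
      rw [hL]
      have h1 := norm_form_le (ha := ha n) u v
      have h2 := norm_form_le (ha := hb) u v
      have h3 : ‖ofDomain (ha n) u‖ * ‖ofDomain (ha n) v‖ ≤
          (c n * ‖ofDomain hb u‖) * (c n * ‖ofDomain hb v‖) :=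
        mul_le_mul (hc n u) (hc n v) (norm_nonneg _) (mul_nonneg (hc0 n) (norm_nonneg _))
      have h4 := norm_sub_le (a n u v) (b u v)
      linarith
  -- If `δ n = 0`, then `S n = 0`; such `n` are treated separately at the end.
  let S n : FormSpace b hb →L⋆[ℂ] FormSpace b hb →L[ℂ] ℂ := ((δ n)⁻¹ : ℂ) • T n
  have hS n (u v : D) : S n (ofDomain hb u) (ofDomain hb v) = ((δ n)⁻¹ : ℂ) * (a n u v - b u v) :=
    rfl
  -- Uniform boundedness is used twice: in `v` for fixed `u`, then in `u`.
  obtain ⟨C, hC⟩ := banach_steinhaus (g := S) fun u => by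
    obtain ⟨u, rfl⟩ := (ofDomain hb).surjective u
    refine banach_steinhaus (g := fun n => S n (ofDomain hb u)) fun v => ?_
    obtain ⟨v, rfl⟩ := (ofDomain hb).surjective v
    obtain ⟨C, hC⟩ := h u v
    refine ⟨max C 0, fun n => ?_⟩
    rw [hS, norm_mul, norm_inv, Complex.norm_real, Real.norm_of_nonneg (hδ n)]
    rcases (hδ n).eq_or_lt with h0 | h0
    · rw [← h0]; simp
    · rw [inv_mul_le_iff₀ h0, mul_comm]
      exact (hC n).trans (by gcongr; exact le_max_left _ _)
  refine ⟨C, (norm_nonneg _).trans (hC 0), fun n u v => ?_⟩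
  rcases (hδ n).eq_or_lt with h0 | h0
  · obtain ⟨C', hC'⟩ := h u v
    have := hC' n
    rw [← h0] at this ⊢
    simpa using this
  · have h1 := ((S n).le_opNorm₂ (ofDomain hb u) (ofDomain hb v))
    rw [hS, norm_mul, norm_inv, Complex.norm_real, Real.norm_of_nonneg (hδ n),
      inv_mul_le_iff₀ h0] at h1
    calc _ ≤ _ := h1
      _ ≤ δ n * (C * ‖ofDomain hb u‖ * ‖ofDomain hb v‖) := by gcongr; exact hC n
      _ = _ := by ring

/-- Let `u`, `u₀` solve the two equations for `w` and `d = u - u₀`. Then `b(d, d) = b(d, u) - a(d,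
u)`, so in the norm of `b`, `‖d‖ ≤ ε ‖u‖ ≤ ε (‖d‖ + ‖w‖)`; `ε ≤ 1 / 2` absorbs `‖d‖`, whence the
factor `2`. -/
theorem norm_inverse_sub_le {a b : D →ₗ⋆[ℂ] D →ₗ[ℂ] ℂ} (ha : IsCoerciveForm a)
    (hb : IsCoerciveForm b) {ε : ℝ} (hε : 0 ≤ ε) (hε' : ε ≤ 1 / 2)
    (h : ∀ u v, ‖a u v - b u v‖ ≤ ε * ‖ofDomain hb u‖ * ‖ofDomain hb v‖) :
    ‖inverse ha - inverse hb‖ ≤ 2 * ε := by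
  refine ContinuousLinearMap.opNorm_le_bound _ (by positivity) fun w => ?_
  set u := solve ha w with hu
  set u₀ := solve hb w with hu₀
  have h1 : ‖ofDomain hb (u - u₀)‖ ^ 2 ≤
      ε * ‖ofDomain hb (u - u₀)‖ * ‖ofDomain hb u‖ := by
    rw [sq_norm_ofDomain]
    have h2 : b (u - u₀) (u - u₀) = -(a (u - u₀) u - b (u - u₀) u) := by
      rw [map_sub (b (u - u₀)), form_solve (ha := hb), form_solve (ha := ha)]
      ring
    rw [h2]
    exact (Complex.re_le_norm _).trans (by rw [norm_neg]; exact h _ _)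
  have h2 : ‖ofDomain hb (u - u₀)‖ ≤ ε * ‖ofDomain hb u‖ := by
    rcases (norm_nonneg (ofDomain hb (u - u₀))).eq_or_lt with h0 | h0
    · rw [← h0]; positivity
    · exact le_of_mul_le_mul_left (by linarith) h0
  have h3 : ‖ofDomain hb u‖ ≤ ‖ofDomain hb (u - u₀)‖ + ‖w‖ := by
    calc ‖ofDomain hb u‖ = ‖ofDomain hb (u - u₀) + ofDomain hb u₀‖ := by
          rw [← map_add, sub_add_cancel]
      _ ≤ _ := (norm_add_le _ _).trans (by gcongr; exact norm_ofDomain_solve_le w)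
  have h4 : ‖(inverse ha - inverse hb) w‖ ≤ ‖ofDomain hb (u - u₀)‖ :=
    norm_le_norm_ofDomain (ha := hb) (u - u₀)
  have h5 := norm_nonneg (ofDomain hb (u - u₀))
  have h6 : ε * ‖ofDomain hb u‖ ≤ ε * (‖ofDomain hb (u - u₀)‖ + ‖w‖) := by gcongr
  have h7 : ε * ‖ofDomain hb (u - u₀)‖ ≤ 1 / 2 * ‖ofDomain hb (u - u₀)‖ := by gcongr
  linarith

theorem tendsto_inverse {a : ℕ → D →ₗ⋆[ℂ] D →ₗ[ℂ] ℂ} {b : D →ₗ⋆[ℂ] D →ₗ[ℂ] ℂ}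
    (ha : ∀ n, IsCoerciveForm (a n)) (hb : IsCoerciveForm b) {δ : ℕ → ℝ} (hδ : ∀ n, 0 ≤ δ n)
    (hδ' : Tendsto δ atTop (𝓝 0)) (h : ∀ u v, ∃ C : ℝ, ∀ n, ‖a n u v - b u v‖ ≤ C * δ n) :
    Tendsto (fun n => inverse (ha n)) atTop (𝓝 (inverse hb)) := by
  obtain ⟨C, hC, hbound⟩ := exists_uniform_form_bound ha hb hδ h
  have hCδ : Tendsto (fun n => C * δ n) atTop (𝓝 0) := by simpa using hδ'.const_mul C
  rw [tendsto_iff_norm_sub_tendsto_zero]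
  refine squeeze_zero' (.of_forall fun _ => norm_nonneg _) ?_
    (by simpa using hCδ.const_mul 2)
  filter_upwards [hCδ.eventually_le_const (show (0 : ℝ) < 1 / 2 by norm_num)] with n hn
  exact norm_inverse_sub_le (ha n) hb (mul_nonneg hC (hδ n)) hn (hbound n)

/-- The inverses of the operators of a holomorphic family of type (a) depend continuously on the
parameter in the operator norm. -/
theorem exists_continuousOn_inverse {D₀ : Set ℂ} (hD₀ : IsOpen D₀) {s : Set ℝ}
    (hs : ∀ t ∈ s, (t : ℂ) ∈ D₀) {a : ℂ → D →ₗ⋆[ℂ] D →ₗ[ℂ] ℂ}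
    (ha : IsHolomorphicOfTypeA a D₀) (hcoer : ∀ t ∈ s, IsCoerciveForm (a (t : ℝ))) :
    ∃ B : ℝ → H →L[ℂ] H, (∀ t (ht : t ∈ s), B t = inverse (hcoer t ht)) ∧ ContinuousOn B s := by
  classical
  let B : ℝ → H →L[ℂ] H := fun t => if ht : t ∈ s then inverse (hcoer t ht) else 0
  have hB : ∀ t (ht : t ∈ s), B t = inverse (hcoer t ht) := fun t ht => dif_pos ht
  refine ⟨B, hB, fun t₀ ht₀ => tendsto_of_seq_tendsto fun x hx => ?_⟩
  obtain ⟨hx0, hxs⟩ := tendsto_nhdsWithin_iff.1 hx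
  rw [eventually_atTop] at hxs
  obtain ⟨N, hN⟩ := hxs
  rw [← tendsto_add_atTop_iff_nat N]
  have hmem : ∀ n, x (n + N) ∈ s := fun n => hN _ (Nat.le_add_left _ _)
  have hx1 : Tendsto (fun n => x (n + N)) atTop (𝓝 t₀) := (tendsto_add_atTop_iff_nat N).2 hx0
  simp only [Function.comp_apply]
  rw [hB t₀ ht₀]
  simp_rw [fun n => hB _ (hmem n)]
  refine tendsto_inverse (δ := fun n => |x (n + N) - t₀|) (fun n => hcoer _ (hmem n)) _
    (fun _ => abs_nonneg _) (tendsto_iff_dist_tendsto_zero.1 hx1) fun u v => ?_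
  have hd : DifferentiableAt ℂ (fun z => a z u v) t₀ :=
    (ha.holomorphic u v).differentiableAt (hD₀.mem_nhds (hs t₀ ht₀))
  have hO := hd.isBigO_sub.comp_tendsto ((Complex.continuous_ofReal.tendsto t₀).comp hx1)
  obtain ⟨C, hC, h⟩ := Asymptotics.bound_of_isBigO_nat_atTop hO
  refine ⟨C, fun n => ?_⟩
  -- The big-O bound holds for every `n` at which the comparison sequence is nonzero; at its zeros
  -- the two forms coincide.
  by_cases h0 : x (n + N) = t₀
  · simp [h0]
  · have := @h n (by simpa [sub_eq_zero] using h0)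
    simpa [← Complex.ofReal_sub] using this

end Continuity

/-! ### Strong convergence composed with compact operators -/

section StrongContinuity

variable {E F G : Type*} [NormedAddCommGroup E] [NormedSpace ℂ E] [NormedAddCommGroup F]
  [NormedSpace ℂ F] [NormedAddCommGroup G] [NormedSpace ℂ G]

/-- A compact operator turns strong convergence into norm convergence. -/
theorem tendsto_comp_of_compact [CompleteSpace F] {K : ℕ → F →L[ℂ] G} {K₀ : F →L[ℂ] G}
    (hK : ∀ x, Tendsto (fun n => K n x) atTop (𝓝 (K₀ x))) {S : ℕ → E →L[ℂ] F} {S₀ : E →L[ℂ] F}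
    (hS : Tendsto S atTop (𝓝 S₀))
    (hcomp : ∀ x : ℕ → E, (∀ n, ‖x n‖ ≤ 1) →
      ∃ (φ : ℕ → ℕ) (y : F), StrictMono φ ∧ Tendsto (fun n => S₀ (x (φ n))) atTop (𝓝 y)) :
    Tendsto (fun n => K n ∘L S n) atTop (𝓝 (K₀ ∘L S₀)) := by
  obtain ⟨C, hC⟩ : ∃ C, ∀ n, ‖K n‖ ≤ C := banach_steinhaus fun x => by
    obtain ⟨C, hC⟩ := (hK x).norm.bddAbove_range
    exact ⟨C, fun n => hC ⟨n, rfl⟩⟩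
  have h1 : Tendsto (fun n => K n ∘L (S n - S₀)) atTop (𝓝 0) := by
    refine squeeze_zero_norm (a := fun n => C * ‖S n - S₀‖) (fun n => ?_) ?_
    · exact (ContinuousLinearMap.opNorm_comp_le _ _).trans (by gcongr; exact hC n)
    · simpa using (tendsto_iff_norm_sub_tendsto_zero.1 hS).const_mul C
  have h2 : Tendsto (fun n => (K n - K₀) ∘L S₀) atTop (𝓝 0) := by
    -- Vectors nearly attaining the norms reduce norm convergence to a statement about one bounded
    -- sequence.
    have hx : ∀ n, ∃ x : E, ‖x‖ ≤ 1 ∧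
        ‖(K n - K₀) ∘L S₀‖ ≤ ‖((K n - K₀) ∘L S₀) x‖ + 1 / ((n : ℝ) + 1) := by
      intro n
      by_contra! hcon
      have hpos : (0 : ℝ) < 1 / ((n : ℝ) + 1) := by positivity
      have h0 := hcon 0 (by simp)
      rw [map_zero, norm_zero, zero_add] at h0
      have := ContinuousLinearMap.opNorm_le_of_unit_norm (𝕜 := ℂ) (f := (K n - K₀) ∘L S₀)
        (C := ‖(K n - K₀) ∘L S₀‖ - 1 / ((n : ℝ) + 1)) (by linarith)
        fun x hx => by linarith [hcon x hx.le]
      linarith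
    choose x hx1 hx2 using hx
    refine tendsto_of_subseq_tendsto fun ns hns => ?_
    obtain ⟨φ, y, hφ, hy⟩ := hcomp (fun n => x (ns n)) fun n => hx1 _
    have hm : Tendsto (fun n => ns (φ n)) atTop atTop := hns.comp hφ.tendsto_atTop
    refine ⟨φ, squeeze_zero_norm (a := fun n => ((C + ‖K₀‖) * ‖S₀ (x (ns (φ n))) - y‖ +
      ‖K (ns (φ n)) y - K₀ y‖) + 1 / ((ns (φ n) : ℝ) + 1)) (fun n => ?_) ?_⟩
    · refine (hx2 (ns (φ n))).trans (add_le_add_left ?_ _)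
      set m := ns (φ n)
      -- Split at the limit `y`: the first term is small by the uniform bound on `K`, the second by
      -- strong convergence.
      have h3 : ((K m - K₀) ∘L S₀) (x m) = (K m - K₀) (S₀ (x m) - y) + (K m y - K₀ y) := by
        simp only [ContinuousLinearMap.comp_apply, _root_.sub_apply, map_sub]
        abel
      rw [h3]
      refine (norm_add_le _ _).trans (add_le_add_left ?_ _)
      refine ((K m - K₀).le_opNorm _).trans ?_
      gcongr
      exact (norm_sub_le _ _).trans (by gcongr; exact hC m)
    · have h4 := (tendsto_iff_norm_sub_tendsto_zero.1 hy).const_mul (C + ‖K₀‖)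
      have h5 := (tendsto_iff_norm_sub_tendsto_zero.1 (hK y)).comp hm
      have h6 := (tendsto_one_div_add_atTop_nhds_zero_nat (𝕜 := ℝ)).comp hm
      simpa [Function.comp_def] using (h4.add h5).add h6
  have h3 := (h1.add h2).add_const (K₀ ∘L S₀)
  rw [add_zero, zero_add] at h3
  refine h3.congr fun n => ?_
  ext x
  simp

end StrongContinuity

/-- The inverse maps the unit ball of `H` into the unit ball of the form norm, so relative form
compactness of `P` makes `P A⁻¹` compact. -/
theorem FormSpace.exists_tendsto_comp_inverse {H : Type*} [NormedAddCommGroup H]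
    [InnerProductSpace ℂ H] [CompleteSpace H] {D : Submodule ℂ H} {a : D →ₗ⋆[ℂ] D →ₗ[ℂ] ℂ}
    (ha : IsCoerciveForm a) {P : H →L[ℂ] H} (hP : IsRelativelyFormCompact P a) (x : ℕ → H)
    (hx : ∀ n, ‖x n‖ ≤ 1) : ∃ (φ : ℕ → ℕ) (y : H), StrictMono φ ∧
      Tendsto (fun n => P (inverse ha (x (φ n)))) atTop (𝓝 y) := by
  refine hP (fun n => solve ha (x n)) ⟨1, fun n => ?_⟩
  have h := (norm_ofDomain_solve_le (ha := ha) (x n)).trans (hx n)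
  refine ⟨(norm_le_norm_ofDomain _).trans h, (norm_form_le (ha := ha) _ _).trans ?_⟩
  exact mul_le_one₀ h (norm_nonneg _) h

/-! ### Block diagonal operators -/

section Block

variable {H₁ H₂ : Type*} [NormedAddCommGroup H₁] [InnerProductSpace ℂ H₁]
  [NormedAddCommGroup H₂] [InnerProductSpace ℂ H₂]

theorem mem_graph_blockDiagonal (S : H₁ →ₗ.[ℂ] H₁) (T : H₂ →ₗ.[ℂ] H₂)
    (p : WithLp 2 (H₁ × H₂) × WithLp 2 (H₁ × H₂)) :
    p ∈ (blockDiagonal S T).graph ↔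
      (p.1.fst, p.2.fst) ∈ S.graph ∧ (p.1.snd, p.2.snd) ∈ T.graph := by
  simp only [LinearPMap.mem_graph_iff]
  constructor
  · rintro ⟨y, hy, h⟩
    rw [← hy, ← h]
    exact ⟨⟨⟨_, y.2.1⟩, rfl, rfl⟩, ⟨⟨_, y.2.2⟩, rfl, rfl⟩⟩
  · rintro ⟨⟨u, hu, hu'⟩, v, hv, hv'⟩
    refine ⟨⟨WithLp.toLp 2 ((u : H₁), (v : H₂)), u.2, v.2⟩, ?_, ?_⟩
    · exact WithLp.ofLp_injective 2 (Prod.ext hu hv)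
    · change WithLp.toLp 2 (S u, T v) = p.2
      rw [hu', hv']; rfl

theorem boundedBlockDiagonal_comp (P P' : H₁ →L[ℂ] H₁) (Q Q' : H₂ →L[ℂ] H₂) :
    boundedBlockDiagonal P Q ∘L boundedBlockDiagonal P' Q' =
      boundedBlockDiagonal (P ∘L P') (Q ∘L Q') := rfl

theorem ContinuousOn.boundedBlockDiagonal {X : Type*} [TopologicalSpace X] {s : Set X}
    {P : X → H₁ →L[ℂ] H₁} {Q : X → H₂ →L[ℂ] H₂} (hP : ContinuousOn P s) (hQ : ContinuousOn Q s) :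
    ContinuousOn (fun t => boundedBlockDiagonal (P t) (Q t)) s :=
  continuousOn_const.clm_comp ((hP.prod_mapL ℂ hQ).clm_comp continuousOn_const)

theorem isSelfAdjoint_boundedBlockDiagonal [CompleteSpace H₁] [CompleteSpace H₂]
    {P : H₁ →L[ℂ] H₁} {Q : H₂ →L[ℂ] H₂} (hP : IsSelfAdjoint P) (hQ : IsSelfAdjoint Q) :
    IsSelfAdjoint (boundedBlockDiagonal P Q) := by
  rw [ContinuousLinearMap.isSelfAdjoint_iff_isSymmetric]
  intro x y
  have h1 : inner ℂ (P x.fst) y.fst = inner ℂ x.fst (P y.fst) := hP.isSymmetric _ _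
  have h2 : inner ℂ (Q x.snd) y.snd = inner ℂ x.snd (Q y.snd) := hQ.isSymmetric _ _
  rw [ContinuousLinearMap.coe_coe, WithLp.prod_inner_apply, WithLp.prod_inner_apply]
  exact congrArg₂ (· + ·) h1 h2

theorem boundedBlockDiagonal_injective {P : H₁ →L[ℂ] H₁} {Q : H₂ →L[ℂ] H₂}
    (hP : Function.Injective P) (hQ : Function.Injective Q) :
    Function.Injective (boundedBlockDiagonal P Q) := by
  intro x y h
  have h1 : P x.fst = P y.fst := congrArg WithLp.fst h
  have h2 : Q x.snd = Q y.snd := congrArg WithLp.snd h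
  exact WithLp.ofLp_injective 2 (Prod.ext (hP h1) (hQ h2))

theorem exists_tendsto_boundedBlockDiagonal {P : H₁ →L[ℂ] H₁} {Q : H₂ →L[ℂ] H₂}
    (hP : ∀ x : ℕ → H₁, (∀ n, ‖x n‖ ≤ 1) → ∃ (φ : ℕ → ℕ) (y : H₁), StrictMono φ ∧
      Tendsto (fun n => P (x (φ n))) atTop (𝓝 y))
    (hQ : ∀ x : ℕ → H₂, (∀ n, ‖x n‖ ≤ 1) → ∃ (φ : ℕ → ℕ) (y : H₂), StrictMono φ ∧
      Tendsto (fun n => Q (x (φ n))) atTop (𝓝 y))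
    (x : ℕ → WithLp 2 (H₁ × H₂)) (hx : ∀ n, ‖x n‖ ≤ 1) :
    ∃ (φ : ℕ → ℕ) (y : WithLp 2 (H₁ × H₂)), StrictMono φ ∧
      Tendsto (fun n => boundedBlockDiagonal P Q (x (φ n))) atTop (𝓝 y) := by
  obtain ⟨φ, y, hφ, hy⟩ := hP (fun n => (x n).fst) fun n =>
    (WithLp.norm_fst_le _ (x n)).trans (hx n)
  obtain ⟨ψ, w, hψ, hw⟩ := hQ (fun n => (x (φ n)).snd) fun n =>
    (WithLp.norm_snd_le _ (x (φ n))).trans (hx _)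
  refine ⟨φ ∘ ψ, WithLp.toLp 2 (y, w), hφ.comp hψ, ?_⟩
  have h := (hy.comp hψ.tendsto_atTop).prodMk_nhds hw
  exact ((WithLp.prod_continuous_toLp 2 H₁ H₂).tendsto (y, w)).comp h

theorem mem_graph_neg_iff {T : H₂ →ₗ.[ℂ] H₂} {B : H₂ →L[ℂ] H₂}
    (hT : ∀ p, p ∈ T.graph ↔ p.1 = B p.2) (p : H₂ × H₂) :
    p ∈ (-T).graph ↔ p.1 = (-B) p.2 := by
  have h : p ∈ (-T).graph ↔ (p.1, -p.2) ∈ T.graph := by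
    simp only [LinearPMap.mem_graph_iff]
    constructor
    · rintro ⟨y, hy, h⟩
      exact ⟨y, hy, by rw [← h]; exact (neg_neg (T y)).symm⟩
    · rintro ⟨y, hy, h⟩
      refine ⟨y, hy, ?_⟩
      change -T y = p.2
      rw [h, neg_neg]
  rw [h, hT]
  simp

theorem mem_graph_blockDiagonal_iff {S : H₁ →ₗ.[ℂ] H₁} {T : H₂ →ₗ.[ℂ] H₂}
    {B₁ : H₁ →L[ℂ] H₁} {B₂ : H₂ →L[ℂ] H₂} (hS : ∀ p, p ∈ S.graph ↔ p.1 = B₁ p.2)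
    (hT : ∀ p, p ∈ T.graph ↔ p.1 = B₂ p.2) (p : WithLp 2 (H₁ × H₂) × WithLp 2 (H₁ × H₂)) :
    p ∈ (blockDiagonal S T).graph ↔ p.1 = boundedBlockDiagonal B₁ B₂ p.2 := by
  rw [mem_graph_blockDiagonal, hS, hT]
  constructor
  · rintro ⟨h1, h2⟩
    exact WithLp.ofLp_injective 2 (Prod.ext h1 h2)
  · intro h
    rw [h]
    exact ⟨rfl, rfl⟩

end Block

/-! ### Norm resolvent continuity -/

theorem IsResolventAt.unboundedResolvent_eq {H : Type*} [NormedAddCommGroup H]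
    [InnerProductSpace ℂ H] {T : H →ₗ.[ℂ] H} {z : ℂ} {R : H →L[ℂ] H} (h : IsResolventAt T z R) :
    unboundedResolvent T z = R := by
  have hex : ∃ R : H →L[ℂ] H, IsResolventAt T z R := ⟨R, h⟩
  rw [unboundedResolvent, dif_pos hex]
  exact hex.choose_spec.unique h

/-- Norm resolvent continuity of `T x + K x`, if `T x` is the inverse of `B x`, and `B` and `K B`
are continuous in the operator norm. -/
theorem normResolventContinuousOn_vadd {X H : Type*} [TopologicalSpace X] [NormedAddCommGroup H]
    [InnerProductSpace ℂ H] [CompleteSpace H] {s : Set X} {T : X → H →ₗ.[ℂ] H}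
    {B K : X → H →L[ℂ] H} (hT : ∀ x ∈ s, ∀ p, p ∈ (T x).graph ↔ p.1 = B x p.2)
    (hB : ∀ x ∈ s, IsSelfAdjoint (B x)) (hBi : ∀ x ∈ s, Function.Injective (B x))
    (hK : ∀ x ∈ s, IsSelfAdjoint (K x)) (hBc : ContinuousOn B s)
    (hKB : ContinuousOn (fun x => K x * B x) s) :
    NormResolventContinuousOn (fun x => (K x).toLinearMap +ᵥ T x) s := by
  refine ⟨fun x hx => isSelfAdjoint_vadd (hT x hx) (hB x hx) (hBi x hx) (hK x hx),
    fun z hz => ?_⟩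
  have hU x (hx : x ∈ s) : IsUnit (birmanSchwinger (B x) (K x) z) :=
    isUnit_birmanSchwinger (hB x hx) (hK x hx) hz
  have hR x (hx : x ∈ s) := isResolventAt_vadd (hT x hx) (hU x hx)
  refine ⟨fun x hx => ⟨_, hR x hx⟩, ?_⟩
  refine ContinuousOn.congr ?_ fun x hx => (hR x hx).unboundedResolvent_eq
  refine hBc.mul fun x hx => ?_
  -- Only the product `K B` enters, so `K` alone need not be norm continuous.
  have hc : ContinuousOn (fun x => birmanSchwinger (B x) (K x) z) s := by
    have : ContinuousOn (fun x => 1 + (K x * B x - z • B x)) s :=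
      continuousOn_const.add (hKB.sub (hBc.const_smul z))
    refine this.congr fun x _ => ?_
    simp only [birmanSchwinger, sub_mul, smul_mul_assoc, one_mul]
  obtain ⟨u, hu⟩ := hU x hx
  have hi := NormedRing.inverse_continuousAt u
  rw [hu] at hi
  exact hi.comp_continuousWithinAt (f := fun x => birmanSchwinger (B x) (K x) z) (hc x hx)

theorem mainTheorem3
    {H₁ H₂ : Type*} [NormedAddCommGroup H₁] [InnerProductSpace ℂ H₁] [CompleteSpace H₁]
    [NormedAddCommGroup H₂] [InnerProductSpace ℂ H₂] [CompleteSpace H₂]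
    -- an open neighbourhood of `[0, 1]` in the complex plane
    (D₀ : Set ℂ) (hD₀ : IsOpen D₀) (hD₀I : ∀ t ∈ Icc (0 : ℝ) 1, (t : ℂ) ∈ D₀)
    -- (i) the forms of the operators `A₊` and `A₋`
    {D₁ : Submodule ℂ H₁} {D₂ : Submodule ℂ H₂}
    (a₁ : ℂ → D₁ →ₗ⋆[ℂ] D₁ →ₗ[ℂ] ℂ) (a₂ : ℂ → D₂ →ₗ⋆[ℂ] D₂ →ₗ[ℂ] ℂ)
    (ha₁ : IsHolomorphicOfTypeA a₁ D₀) (ha₂ : IsHolomorphicOfTypeA a₂ D₀)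
    (hsymm₁ : ∀ t : ℝ, (t : ℂ) ∈ D₀ → IsSymmetricForm (a₁ t))
    (hsymm₂ : ∀ t : ℝ, (t : ℂ) ∈ D₀ → IsSymmetricForm (a₂ t))
    -- (ii) the gap
    (hgap₁ : ∀ t ∈ Icc (0 : ℝ) 1, IsStrictlyAbove (formOperator (a₁ t)) 1)
    (hgap₂ : ∀ t ∈ Icc (0 : ℝ) 1, IsStrictlyAbove (formOperator (a₂ t)) 1)
    -- (iii) the bounded, symmetric, strongly continuous perturbation
    (K : ℝ → WithLp 2 (H₁ × H₂) →L[ℂ] WithLp 2 (H₁ × H₂))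
    (hKsymm : ∀ t ∈ Icc (0 : ℝ) 1, (K t).toLinearMap.IsSymmetric)
    (hKcont : ∀ x, ContinuousOn (fun t => K t x) (Icc (0 : ℝ) 1))
    -- (iv) compactness
    (P₁ : H₁ →L[ℂ] H₁) (P₂ : H₂ →L[ℂ] H₂)
    (hP₁symm : P₁.toLinearMap.IsSymmetric) (hP₂symm : P₂.toLinearMap.IsSymmetric)
    (hP₁ : ∀ t ∈ Icc (0 : ℝ) 1, IsRelativelyFormCompact P₁ (a₁ t))
    (hP₂ : ∀ t ∈ Icc (0 : ℝ) 1, IsRelativelyFormCompact P₂ (a₂ t))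
    (hKP : ∀ t ∈ Icc (0 : ℝ) 1, K t = K t ∘L boundedBlockDiagonal P₁ P₂) :
    NormResolventContinuousOn (fun t : ℝ => perturbedOperator (a₁ t) (a₂ t) (K t))
      (Icc (0 : ℝ) 1) := by
  have hc₁ : ∀ t ∈ Icc (0 : ℝ) 1, IsCoerciveForm (a₁ t) := fun t ht =>
    .of_isStrictlyAbove ha₁.dense (hsymm₁ t (hD₀I t ht)) (ha₁.closed _ (hD₀I t ht))
      (ha₁.sectorial _ (hD₀I t ht)) (hgap₁ t ht)
  have hc₂ : ∀ t ∈ Icc (0 : ℝ) 1, IsCoerciveForm (a₂ t) := fun t ht =>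
    .of_isStrictlyAbove ha₂.dense (hsymm₂ t (hD₀I t ht)) (ha₂.closed _ (hD₀I t ht))
      (ha₂.sectorial _ (hD₀I t ht)) (hgap₂ t ht)
  obtain ⟨B₁, hB₁, hB₁c⟩ := exists_continuousOn_inverse hD₀ hD₀I ha₁ hc₁
  obtain ⟨B₂, hB₂, hB₂c⟩ := exists_continuousOn_inverse hD₀ hD₀I ha₂ hc₂
  have hBc := hB₁c.boundedBlockDiagonal hB₂c.neg
  refine normResolventContinuousOn_vadd
    (B := fun t => boundedBlockDiagonal (B₁ t) (-B₂ t)) (fun t ht => ?_) (fun t ht => ?_)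
    (fun t ht => ?_) (fun t ht => ?_) hBc fun t₀ ht₀ => ?_
  · rw [hB₁ t ht, hB₂ t ht]
    exact mem_graph_blockDiagonal_iff (FormSpace.mem_graph_formOperator ha₁.dense)
      (mem_graph_neg_iff (FormSpace.mem_graph_formOperator ha₂.dense))
  · rw [hB₁ t ht, hB₂ t ht]
    exact isSelfAdjoint_boundedBlockDiagonal FormSpace.isSelfAdjoint_inverse
      FormSpace.isSelfAdjoint_inverse.neg
  · rw [hB₁ t ht, hB₂ t ht]
    exact boundedBlockDiagonal_injective (FormSpace.inverse_injective ha₁.dense)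
      (neg_injective.comp (FormSpace.inverse_injective ha₂.dense))
  · exact ContinuousLinearMap.isSelfAdjoint_iff_isSymmetric.2 (hKsymm t ht)
  · set P := boundedBlockDiagonal P₁ P₂ with hP
    -- Inserting `P` isolates the factor `P B`, which is norm continuous and compact at `t₀`.
    have hcongr : ∀ t ∈ Icc (0 : ℝ) 1, K t * boundedBlockDiagonal (B₁ t) (-B₂ t) =
        K t ∘L (P ∘L boundedBlockDiagonal (B₁ t) (-B₂ t)) := fun t ht => by
      nth_rw 1 [hKP t ht]
      rfl
    refine ContinuousWithinAt.congr ?_ hcongr (hcongr t₀ ht₀)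
    refine tendsto_of_seq_tendsto fun x hx => ?_
    refine tendsto_comp_of_compact (fun y => (hKcont y t₀ ht₀).tendsto.comp hx)
      (((continuousOn_const.clm_comp hBc) t₀ ht₀).tendsto.comp hx) ?_
    rw [hP, boundedBlockDiagonal_comp, hB₁ t₀ ht₀, hB₂ t₀ ht₀]
    refine exists_tendsto_boundedBlockDiagonal
      (FormSpace.exists_tendsto_comp_inverse (hc₁ t₀ ht₀) (hP₁ t₀ ht₀)) fun y hy => ?_
    obtain ⟨φ, w, hφ, h⟩ :=
      FormSpace.exists_tendsto_comp_inverse (hc₂ t₀ ht₀) (hP₂ t₀ ht₀) y hy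
    exact ⟨φ, -w, hφ, by simpa using h.neg⟩
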